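/- Let $\mathbb{D}=\{z\in\mathbb{C}:|z|<1\}$, and for $z\in\mathbb{D}$ let $d(z)=1-|z|$ be the Euclidean distance from $z$ to $\partial\mathbb{D}$. Write $\mathbb{D}(z,r)$ for the open disk with centre $z$ and radius $r$, $|\mathbb{D}(z,r)|$ for its area and $dA$ for Lebesgue measure on $\mathbb{C}$. A \emph{majorant} is a continuous non-decreasing function $\omega:[0,\infty)\to[0,\infty)$, not identically zero (hence positive on $(0,\infty)$), with $\omega(0)=0$, such that $\omega(t)/t$ is non-increasing for $t>0$. Let $\omega$ be a majorant, let $g:\overline{\mathbb{D}}\to\mathbb{C}$ be continuous, and let $f:\overline{\mathbb{D}}\to\mathbb{C}$ be continuous on $\overline{\mathbb{D}}$, twice continuously differentiable (in the real sense) in $\mathbb{D}$, with $\Delta f=g$ in $\mathbb{D}$. Let $0\le s<1$ and $1\le\alpha\le s+1$. Consider the following statements. (1) $f\in\mathcal{B}_\omega^\alpha$, that is, $f\in C^1(\mathbb{D})$ and $\sup_{z\in\mathbb{D}}\|D_f(z)\|\,\omega\big(d(z)^\alpha\big)<\infty$, where $\|D_f(z)\|=|f_z(z)|+|f_{\bar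 z}(z)|$ is the operator norm of the real derivative of $f$ at $z$. (2) There is a constant $C>0$ such that for all $z\in\mathbb{D}$ and all $r\in(0,d(z)]$, $$\frac{1}{|\mathbb{D}(z,r)|}\int_{\mathbb{D}(z,r)}|f(\zeta)-f(z)|\,dA(\zeta)\le\frac{C\,r}{\omega(r^\alpha)}.$$ (3) There is a constant $C>0$ such that for all $z,w\in\mathbb{D}$ with $z\ne w$, $$\frac{|f(z)-f(w)|}{|z-w|}\le\frac{C}{\omega\big(d(z)^{s}\,d(w)^{\alpha-s}\big)}.$$ If $s>0$, then (1), (2) and (3) are equivalent. If $s=0$ (so that $\alpha=1$), then (1) and (2) are equivalent, and (3) implies (1). -/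

import Mathlib

open MeasureTheory Set

/-- Majorants: continuous increasing `ω : [0, ∞) → [0, ∞)` with `ω 0 = 0` such that `ω t / t` is
non-increasing for `t > 0`. Only the values on `[0, ∞)` matter. "Increasing" is read in the weak
sense; the zero function, for which `1 / ω` is meaningless, is excluded. -/
structure IsMajorant (ω : ℝ → ℝ) : Prop where
  continuousOn : ContinuousOn ω (Ici 0)
  monotoneOn : MonotoneOn ω (Ici 0)
  map_zero : ω 0 = 0
  antitoneOn_div : AntitoneOn (fun t => ω t / t) (Ioi 0)
  pos : ∀ t, 0 < t → 0 < ω t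

/-- The open unit disk. -/
def unitDisk : Set ℂ := Metric.ball 0 1

/-- `d(z)`: the Euclidean distance from `z` to the boundary of the unit disk. -/
noncomputable def bdryDist (z : ℂ) : ℝ := Metric.infDist z (frontier unitDisk)

/-- `f` is continuous on the closed disk, `C²` (in the real sense) in the open disk, and solves
the Poisson equation `Δ f = g` there. -/
structure IsPoissonSolution (g f : ℂ → ℂ) : Prop where
  continuousOn : ContinuousOn f (closure unitDisk)
  contDiffOn : ContDiffOn ℝ 2 f unitDisk
  laplacian_eq : ∀ z ∈ unitDisk, Laplacian.laplacian f z = g z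

/-- Bloch type mappings: `f` is `C¹` in the disk and
`sup { ‖D_f(z)‖ ω(d(z)^α) : z ∈ 𝔻 } < ∞`. The norm is the operator norm of the real
derivative of `f` at `z`. -/
def IsBlochType (ω : ℝ → ℝ) (α : ℝ) (f : ℂ → ℂ) : Prop :=
  ContDiffOn ℝ 1 f unitDisk ∧
    BddAbove ((fun z => ‖fderiv ℝ f z‖ * ω (bdryDist z ^ α)) '' unitDisk)

/-- The mean oscillation of `f` over each disk `𝔻(z, r) ⊆ 𝔻` about `z` is at most
`C r / ω(r^α)`. -/
def HasMeanOscillationBound (ω : ℝ → ℝ) (α : ℝ) (f : ℂ → ℂ) : Prop :=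
  ∃ C : ℝ, 0 < C ∧ ∀ z ∈ unitDisk, ∀ r ∈ Ioc 0 (bdryDist z),
    (1 / (volume (Metric.ball z r)).toReal) * ∫ ζ in Metric.ball z r, ‖f ζ - f z‖
      ≤ C * r / ω (r ^ α)

/-- The weighted Lipschitz bound `|f(z) - f(w)| / |z - w| ≤ C / ω(d(z)^s d(w)^(α - s))`. -/
def HasWeightedLipschitzBound (ω : ℝ → ℝ) (s α : ℝ) (f : ℂ → ℂ) : Prop :=
  ∃ C : ℝ, 0 < C ∧ ∀ z ∈ unitDisk, ∀ w ∈ unitDisk, z ≠ w →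
    ‖f z - f w‖ / ‖z - w‖ ≤ C / ω (bdryDist z ^ s * bdryDist w ^ (α - s))

/-! The Bloch bound is the hub. The majorant enters through monotonicity and `ω (c x) ≥ c ω x` for
`0 < c ≤ 1`, which turn comparisons of boundary distances into comparisons of values of `ω`.

The Lipschitz bound gives the Bloch bound on letting `w → z`. Conversely, the derivative bound is
integrated along `[z, w]`. As `d` is concave, `d` on the segment is at least the linear
interpolation of `d(z)` and `d(w)`, and the resulting integrals are bounded uniformly in `z, w` when
`0 < s < 1` (`norm_sub_le_of_bdryDist_ge`, `norm_sub_le_of_bdryDist_lt`).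

The Bloch bound gives the oscillation bound by integrating along radii of `𝔻(z, r)`: the estimate
blows up at the rim only like an integrable power, since `α < 2` (`norm_sub_le_of_mem_ball`).

From oscillation to Bloch the Poisson equation is needed. For `c = ± i` put `W_c = ∂₁ - c ∂₂`, so
that `W_{-c} W_c = Δ`. The Fourier coefficient of `f` on a circle against `exp(-cθ)` recovers `W_c
f(z)` with an error controlled by `sup |g|`. The weight has mean zero, so `f` may be replaced by `f
- f(z)`; integration over radii then bounds `W_c f(z)` by the mean oscillation plus a multiple of
the radius (`norm_wirtinger_le`). The radius used is `d(z)`. -/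

/-! ### Distance to the boundary of the disk. -/

theorem mem_unitDisk {z : ℂ} : z ∈ unitDisk ↔ ‖z‖ < 1 := by
  simp [unitDisk]

theorem isOpen_unitDisk : IsOpen unitDisk := Metric.isOpen_ball

theorem closure_unitDisk : closure unitDisk = Metric.closedBall 0 1 :=
  closure_ball 0 one_ne_zero

theorem bdryDist_eq {z : ℂ} (hz : z ∈ unitDisk) : bdryDist z = 1 - ‖z‖ := by
  have hz' := mem_unitDisk.1 hz
  have hfr : frontier unitDisk = Metric.sphere (0 : ℂ) 1 := frontier_ball 0 one_ne_zero
  rw [bdryDist, hfr]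
  apply le_antisymm
  · obtain ⟨w, hw, hdist⟩ : ∃ w ∈ Metric.sphere (0 : ℂ) 1, dist z w = 1 - ‖z‖ := by
      rcases eq_or_ne z 0 with rfl | h0
      · exact ⟨1, by simp, by simp⟩
      · have hn : 0 < ‖z‖ := norm_pos_iff.2 h0
        refine ⟨(‖z‖⁻¹ : ℝ) • z, ?_, ?_⟩
        · simp [hn.ne']
        · have : z - (‖z‖⁻¹ : ℝ) • z = (1 - ‖z‖⁻¹ : ℝ) • z := by rw [sub_smul, one_smul]
          rw [dist_eq_norm, this, norm_smul, Real.norm_eq_abs, abs_of_nonpos]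
          · field_simp
            ring
          · have := (one_le_inv₀ hn).2 hz'.le
            linarith
    exact hdist ▸ Metric.infDist_le_dist_of_mem hw
  · refine (Metric.le_infDist ⟨1, by simp⟩).2 fun w hw => ?_
    have hw1 : ‖w‖ = 1 := by simpa using hw
    rw [dist_comm, dist_eq_norm]
    linarith [norm_sub_norm_le w z]

theorem bdryDist_pos {z : ℂ} (hz : z ∈ unitDisk) : 0 < bdryDist z := by
  rw [bdryDist_eq hz]
  linarith [mem_unitDisk.1 hz]

theorem bdryDist_le_one {z : ℂ} (hz : z ∈ unitDisk) : bdryDist z ≤ 1 := by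
  rw [bdryDist_eq hz]
  linarith [norm_nonneg z]

theorem bdryDist_le_add_dist {z w : ℂ} (hz : z ∈ unitDisk) (hw : w ∈ unitDisk) :
    bdryDist z ≤ bdryDist w + ‖z - w‖ := by
  rw [bdryDist_eq hz, bdryDist_eq hw]
  linarith [norm_sub_norm_le w z, norm_sub_rev w z]

theorem ball_subset_unitDisk {z : ℂ} (hz : z ∈ unitDisk) {r : ℝ} (hr : r ≤ bdryDist z) :
    Metric.ball z r ⊆ unitDisk := by
  rw [bdryDist_eq hz] at hr
  refine Metric.ball_subset_ball' ?_
  rw [dist_zero_right]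
  linarith

theorem closedBall_subset_closure_unitDisk {z : ℂ} (hz : z ∈ unitDisk) {r : ℝ}
    (hr : r ≤ bdryDist z) : Metric.closedBall z r ⊆ closure unitDisk := by
  rw [bdryDist_eq hz] at hr
  rw [closure_unitDisk]
  refine Metric.closedBall_subset_closedBall' ?_
  rw [dist_zero_right]
  linarith

/-! ### Inequalities for majorants. -/

theorem IsMajorant.mono {ω : ℝ → ℝ} (hω : IsMajorant ω) {x y : ℝ} (hx : 0 ≤ x) (hxy : x ≤ y) :
    ω x ≤ ω y :=
  hω.monotoneOn hx (hx.trans hxy) hxy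

/-- Compare `ω t / t` at `c * x ≤ x`. The monotonicity of this quotient is used nowhere else. -/
theorem IsMajorant.mul_le {ω : ℝ → ℝ} (hω : IsMajorant ω) {c x : ℝ} (hc0 : 0 < c) (hc1 : c ≤ 1)
    (hx : 0 < x) : c * ω x ≤ ω (c * x) := by
  have h : ω x / x ≤ ω (c * x) / (c * x) :=
    hω.antitoneOn_div (mul_pos hc0 hx) hx (mul_le_of_le_one_left hx.le hc1)
  rw [div_le_div_iff₀ hx (mul_pos hc0 hx)] at h
  nlinarith

theorem IsMajorant.mul_le_of_mul_le {ω : ℝ → ℝ} (hω : IsMajorant ω) {c x y : ℝ} (hc0 : 0 < c)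
    (hc1 : c ≤ 1) (hx : 0 < x) (h : c * x ≤ y) : c * ω x ≤ ω y :=
  (hω.mul_le hc0 hc1 hx).trans (hω.mono (mul_pos hc0 hx).le h)

theorem IsBlochType.exists_norm_fderiv_le {ω : ℝ → ℝ} (hω : IsMajorant ω) {α : ℝ} {f : ℂ → ℂ}
    (h : IsBlochType ω α f) :
    ∃ M : ℝ, 0 < M ∧ ∀ z ∈ unitDisk, ‖fderiv ℝ f z‖ ≤ M / ω (bdryDist z ^ α) := by
  obtain ⟨M, hM⟩ := h.2
  refine ⟨max M 1, by positivity, fun z hz => ?_⟩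
  rw [le_div_iff₀ (hω.pos _ (Real.rpow_pos_of_pos (bdryDist_pos hz) _))]
  exact (hM ⟨z, hz, rfl⟩).trans (le_max_left _ _)

/-! ### From the Lipschitz bound to the Bloch bound. -/

theorem HasWeightedLipschitzBound.isBlochType {ω : ℝ → ℝ} (hω : IsMajorant ω) {s α : ℝ}
    {f : ℂ → ℂ} (hf : ContDiffOn ℝ 2 f unitDisk) (hα : s ≤ α) (hαs : α ≤ s + 1)
    (h : HasWeightedLipschitzBound ω s α f) : IsBlochType ω α f := by
  obtain ⟨C, hC, hb⟩ := h
  refine ⟨hf.of_le one_le_two, 2 * C, ?_⟩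
  rintro _ ⟨z, hz, rfl⟩
  have hd := bdryDist_pos hz
  have hω0 := hω.pos _ (Real.rpow_pos_of_pos hd α)
  have hdiff : DifferentiableAt ℝ f z :=
    (hf.differentiableOn (by simp)).differentiableAt (isOpen_unitDisk.mem_nhds hz)
  show ‖fderiv ℝ f z‖ * ω (bdryDist z ^ α) ≤ 2 * C
  rw [← le_div_iff₀ hω0]
  refine hdiff.hasFDerivAt.le_of_lip' (by positivity) ?_
  filter_upwards [isOpen_unitDisk.mem_nhds hz, Metric.ball_mem_nhds z (half_pos hd)] with w hw hwz
  rcases eq_or_ne z w with rfl | hne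
  · simp
  rw [Metric.mem_ball, dist_eq_norm] at hwz
  have hdw : bdryDist z / 2 ≤ bdryDist w := by
    have := bdryDist_le_add_dist hz hw
    rw [norm_sub_rev] at this
    linarith
  -- For `w` within `d(z) / 2` of `z`, `d(w) ≥ d(z) / 2`; as `α - s ≤ 1`, the power costs at most a
  -- factor `1 / 2`.
  have hωw : 1 / 2 * ω (bdryDist z ^ α) ≤ ω (bdryDist z ^ s * bdryDist w ^ (α - s)) := by
    refine hω.mul_le_of_mul_le (by norm_num) (by norm_num) (Real.rpow_pos_of_pos hd α) ?_
    have h1 : (bdryDist z / 2) ^ (α - s) ≤ bdryDist w ^ (α - s) :=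
      Real.rpow_le_rpow (by positivity) hdw (by linarith)
    have h2 : (1 / 2 : ℝ) ≤ (1 / 2) ^ (α - s) := by
      have := Real.rpow_le_rpow_of_exponent_ge (x := 1 / 2) (by norm_num) (by norm_num)
        (show α - s ≤ 1 by linarith)
      rwa [Real.rpow_one] at this
    have h3 : bdryDist z ^ α = bdryDist z ^ s * bdryDist z ^ (α - s) := by
      rw [← Real.rpow_add hd]
      ring_nf
    have h4 : (bdryDist z / 2) ^ (α - s) = (1 / 2) ^ (α - s) * bdryDist z ^ (α - s) := by
      rw [← Real.mul_rpow (by norm_num) hd.le]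
      ring_nf
    rw [h3]
    calc 1 / 2 * (bdryDist z ^ s * bdryDist z ^ (α - s))
        ≤ (1 / 2) ^ (α - s) * (bdryDist z ^ s * bdryDist z ^ (α - s)) := by gcongr
      _ = bdryDist z ^ s * (bdryDist z / 2) ^ (α - s) := by rw [h4]; ring
      _ ≤ _ := by gcongr
  have hzw := hb z hz w hw hne
  rw [div_le_iff₀ (norm_pos_iff.2 (sub_ne_zero.2 hne))] at hzw
  rw [norm_sub_rev (f w), norm_sub_rev w]
  refine hzw.trans (mul_le_mul_of_nonneg_right ?_ (norm_nonneg _))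
  calc C / ω (bdryDist z ^ s * bdryDist w ^ (α - s)) ≤ C / (1 / 2 * ω (bdryDist z ^ α)) := by
        gcongr
    _ = 2 * C / ω (bdryDist z ^ α) := by field_simp

/-! ### From the Bloch bound to the Lipschitz bound: integration along segments. -/

theorem add_smul_sub_mem_unitDisk {z w : ℂ} (hz : z ∈ unitDisk) (hw : w ∈ unitDisk) {t : ℝ}
    (ht : t ∈ Icc (0 : ℝ) 1) : z + t • (w - z) ∈ unitDisk :=
  (convex_ball (0 : ℂ) 1).add_smul_sub_mem hz hw ht

/-- Concavity of `1 - ‖·‖`. -/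
theorem le_bdryDist_add_smul_sub {z w : ℂ} (hz : z ∈ unitDisk) (hw : w ∈ unitDisk) {t : ℝ}
    (ht : t ∈ Icc (0 : ℝ) 1) :
    (1 - t) * bdryDist z + t * bdryDist w ≤ bdryDist (z + t • (w - z)) := by
  rw [bdryDist_eq (add_smul_sub_mem_unitDisk hz hw ht), bdryDist_eq hz, bdryDist_eq hw]
  have h : z + t • (w - z) = (1 - t) • z + t • w := by
    rw [smul_sub, sub_smul, one_smul]
    ring
  have h1 := norm_add_le ((1 - t) • z) (t • w)
  rw [norm_smul, norm_smul, Real.norm_of_nonneg ht.1, Real.norm_of_nonneg (sub_nonneg.2 ht.2)] at h1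
  rw [h]
  linarith

/-- Mean value inequality with an explicit antiderivative `B` of the bound. The derivative
conditions stop short of `t = 1`, so `B'` may blow up there, and no integrability has to be checked.
-/
theorem norm_sub_le_of_norm_fderiv_segment_le {f : ℂ → ℂ} (hf : ContDiffOn ℝ 1 f unitDisk)
    {z w : ℂ} (hz : z ∈ unitDisk) (hw : w ∈ unitDisk) {B B' : ℝ → ℝ}
    (hB0 : 0 ≤ B 0) (hB : ContinuousOn B (Icc 0 1))
    (hB' : ∀ t ∈ Ico (0 : ℝ) 1, HasDerivAt B (B' t) t)
    (bound : ∀ t ∈ Ico (0 : ℝ) 1, ‖fderiv ℝ f (z + t • (w - z))‖ ≤ B' t) :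
    ‖f w - f z‖ ≤ B 1 * ‖w - z‖ := by
  have hmem := fun {t : ℝ} (ht : t ∈ Icc (0 : ℝ) 1) => add_smul_sub_mem_unitDisk hz hw ht
  have hderiv : ∀ t ∈ Icc (0 : ℝ) 1, HasDerivAt (fun t : ℝ => f (z + t • (w - z)) - f z)
      (fderiv ℝ f (z + t • (w - z)) (w - z)) t := by
    intro t ht
    have h1 : HasFDerivAt f (fderiv ℝ f (z + t • (w - z))) (z + t • (w - z)) :=
      ((hf.differentiableOn one_ne_zero).differentiableAt
        (isOpen_unitDisk.mem_nhds (hmem ht))).hasFDerivAt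
    have h2 : HasDerivAt (fun t : ℝ => z + t • (w - z)) (w - z) t := by
      simpa using ((hasDerivAt_id t).smul_const (w - z)).const_add z
    exact (h1.comp_hasDerivAt t h2).sub_const _
  have key := image_norm_le_of_norm_deriv_right_le_deriv_boundary'
    (f := fun t : ℝ => f (z + t • (w - z)) - f z)
    (fun t ht => (hderiv t ht).continuousAt.continuousWithinAt)
    (fun t ht => (hderiv t (Ico_subset_Icc_self ht)).hasDerivWithinAt)
    (B := fun t => B t * ‖w - z‖) (B' := fun t => B' t * ‖w - z‖)
    (by simpa using mul_nonneg hB0 (norm_nonneg _))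
    (hB.mul continuousOn_const)
    (fun t ht => ((hB' t ht).mul_const _).hasDerivWithinAt)
    (fun t ht => (ContinuousLinearMap.le_opNorm _ _).trans
      (mul_le_mul_of_nonneg_right (bound t ht) (norm_nonneg _)))
  simpa using key (right_mem_Icc.2 zero_le_one)

/-- With `a = d(z) ≥ b = d(w)`, the distance `L` along the segment is at least both `(1 - t) a` and
`b`. Splitting `L ^ α = L ^ s * L ^ (α - s)` and using one bound in each factor costs `(1 - t) ^
(-s)`, whose integral is `1 / (1 - s)`. -/
theorem norm_sub_le_of_bdryDist_ge {ω : ℝ → ℝ} (hω : IsMajorant ω) {s α M : ℝ} (hs0 : 0 < s)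
    (hs1 : s < 1) (hα : s ≤ α) {f : ℂ → ℂ} (hf : ContDiffOn ℝ 1 f unitDisk) (hM0 : 0 < M)
    (hM : ∀ z ∈ unitDisk, ‖fderiv ℝ f z‖ ≤ M / ω (bdryDist z ^ α))
    {z w : ℂ} (hz : z ∈ unitDisk) (hw : w ∈ unitDisk) (hd : bdryDist w ≤ bdryDist z) :
    ‖f w - f z‖ ≤
      M / ω (bdryDist z ^ s * bdryDist w ^ (α - s)) * (1 / (1 - s)) * ‖w - z‖ := by
  set a := bdryDist z with ha_def
  set b := bdryDist w with hb_def
  have ha : 0 < a := bdryDist_pos hz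
  have hb : 0 < b := bdryDist_pos hw
  set Y := a ^ s * b ^ (α - s) with hY_def
  have hY : 0 < Y := by positivity
  have hωY := hω.pos Y hY
  have h1s : 0 < 1 - s := by linarith
  have key := norm_sub_le_of_norm_fderiv_segment_le hf hz hw
    (B := fun t => M / ω Y * ((1 - (1 - t) ^ (1 - s)) / (1 - s)))
    (B' := fun t => M / ω Y * (1 - t) ^ (-s)) (by simp) ?_ ?_ ?_
  · simpa [Real.zero_rpow h1s.ne'] using key
  · refine ContinuousOn.mul continuousOn_const (ContinuousOn.div_const ?_ _)
    refine continuousOn_const.sub (ContinuousOn.rpow_const (by fun_prop) fun t _ => Or.inr h1s.le)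
  · intro t ht
    have h1t : 0 < 1 - t := by linarith [ht.2]
    have h := ((((hasDerivAt_id t).const_sub 1).rpow_const (p := 1 - s)
      (Or.inl h1t.ne')).const_sub 1).div_const (1 - s) |>.const_mul (M / ω Y)
    refine h.congr_deriv ?_
    simp only [id]
    rw [show (1 - s - 1 : ℝ) = -s by ring]
    field_simp
  · intro t ht
    have h1t : 0 < 1 - t := by linarith [ht.2]
    have ht' := Ico_subset_Icc_self ht
    have hγ := add_smul_sub_mem_unitDisk hz hw ht'
    have hL := le_bdryDist_add_smul_sub hz hw ht'
    set L := bdryDist (z + t • (w - z)) with hL_def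
    have hLpos : 0 < L := bdryDist_pos hγ
    refine (hM _ hγ).trans ?_
    have hXY : (1 - t) ^ s * ω Y ≤ ω (L ^ α) := by
      refine hω.mul_le_of_mul_le (by positivity)
        (Real.rpow_le_one h1t.le (by linarith [ht.1]) hs0.le) hY ?_
      have e1 : ((1 - t) * a) ^ s ≤ L ^ s := by
        refine Real.rpow_le_rpow (by positivity) ?_ hs0.le
        nlinarith [mul_nonneg ht.1 hb.le]
      have e2 : b ^ (α - s) ≤ L ^ (α - s) := by
        refine Real.rpow_le_rpow hb.le ?_ (by linarith)
        nlinarith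
      calc (1 - t) ^ s * Y = ((1 - t) * a) ^ s * b ^ (α - s) := by
            rw [Real.mul_rpow h1t.le ha.le, hY_def]; ring
        _ ≤ L ^ s * L ^ (α - s) := by gcongr
        _ = L ^ α := by rw [← Real.rpow_add hLpos]; ring_nf
    calc M / ω (L ^ α) ≤ M / ((1 - t) ^ s * ω Y) := by gcongr
      _ = M / ω Y * (1 - t) ^ (-s) := by
        rw [Real.rpow_neg h1t.le]; field_simp

/-- With `a = d(z) < b = d(w)` and `l = a + t (b - a)`, the cost at time `t` is `1 + a ^ s * b * l ^
(-s - 1)`, whose integral is at most `1 + 1 / s`. At `s = 0` the same integral contains `b log (b /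
a) / (b - a)`, which is unbounded. -/
theorem norm_sub_le_of_bdryDist_lt {ω : ℝ → ℝ} (hω : IsMajorant ω) {s α M : ℝ} (hs0 : 0 < s)
    (hs1 : s < 1) (hα : s ≤ α) (hαs : α ≤ s + 1) {f : ℂ → ℂ} (hf : ContDiffOn ℝ 1 f unitDisk)
    (hM0 : 0 < M) (hM : ∀ z ∈ unitDisk, ‖fderiv ℝ f z‖ ≤ M / ω (bdryDist z ^ α))
    {z w : ℂ} (hz : z ∈ unitDisk) (hw : w ∈ unitDisk) (hd : bdryDist z < bdryDist w) :
    ‖f w - f z‖ ≤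
      M / ω (bdryDist z ^ s * bdryDist w ^ (α - s)) * (1 + 1 / s) * ‖w - z‖ := by
  set a := bdryDist z with ha_def
  set b := bdryDist w with hb_def
  have ha : 0 < a := bdryDist_pos hz
  have hb : 0 < b := bdryDist_pos hw
  set Y := a ^ s * b ^ (α - s) with hY_def
  have hY : 0 < Y := by positivity
  have hωY := hω.pos Y hY
  have hba : 0 < b - a := by linarith
  have hLpos : ∀ t ∈ Icc (0 : ℝ) 1, 0 < a + t * (b - a) := fun t ht => by
    nlinarith [mul_nonneg ht.1 hba.le]
  have hderiv : ∀ t ∈ Icc (0 : ℝ) 1, HasDerivAt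
      (fun t => M / ω Y * (t + b * a ^ s / (s * (b - a)) * (a ^ (-s) - (a + t * (b - a)) ^ (-s))))
      (M / ω Y * (1 + a ^ s * b * (a + t * (b - a)) ^ (-s - 1))) t := by
    intro t ht
    have h0 : HasDerivAt (fun t => a + t * (b - a)) (b - a) t := by
      simpa using ((hasDerivAt_id t).mul_const (b - a)).const_add a
    have h := (((hasDerivAt_id t).add (((h0.rpow_const (p := -s)
      (Or.inl (hLpos t ht).ne')).const_sub (a ^ (-s))).const_mul
        (b * a ^ s / (s * (b - a)))))).const_mul (M / ω Y)
    refine h.congr_deriv ?_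
    field_simp
  have key := norm_sub_le_of_norm_fderiv_segment_le hf hz hw
    (B := fun t => M / ω Y *
      (t + b * a ^ s / (s * (b - a)) * (a ^ (-s) - (a + t * (b - a)) ^ (-s))))
    (B' := fun t => M / ω Y * (1 + a ^ s * b * (a + t * (b - a)) ^ (-s - 1)))
    (by simp) (fun t ht => (hderiv t ht).continuousAt.continuousWithinAt)
    (fun t ht => hderiv t (Ico_subset_Icc_self ht)) ?_
  · refine key.trans (mul_le_mul_of_nonneg_right ?_ (norm_nonneg _))
    refine mul_le_mul_of_nonneg_left ?_ (by positivity)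
    have e1 : b * a ^ s / (s * (b - a)) * (a ^ (-s) - (a + 1 * (b - a)) ^ (-s))
        = b * (1 - (a / b) ^ s) / (b - a) / s := by
      rw [Real.div_rpow ha.le hb.le, Real.rpow_neg ha.le, one_mul, add_sub_cancel,
        Real.rpow_neg hb.le]
      field_simp
    -- Since `a / b ≤ 1` and `s < 1`, `(a / b) ^ s ≥ a / b`, and `b (1 - a / b) = b - a`.
    have e2 : b * (1 - (a / b) ^ s) / (b - a) ≤ 1 := by
      rw [div_le_one hba]
      have hx : a / b ≤ (a / b) ^ s := by
        have := Real.rpow_le_rpow_of_exponent_ge (x := a / b) (by positivity)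
          ((div_le_one hb).2 hd.le) hs1.le
        rwa [Real.rpow_one] at this
      have : b * (a / b) = a := by field_simp
      nlinarith
    rw [e1]
    gcongr
  · intro t ht
    have ht' := Ico_subset_Icc_self ht
    have hγ := add_smul_sub_mem_unitDisk hz hw ht'
    have hL := le_bdryDist_add_smul_sub hz hw ht'
    have hl := hLpos t ht'
    rw [← ha_def, ← hb_def, show (1 - t) * a + t * b = a + t * (b - a) by ring] at hL
    set l := a + t * (b - a) with hl_def
    have hal : a ≤ l := by nlinarith [mul_nonneg ht.1 hba.le]
    have hlb : l ≤ b := by nlinarith [mul_nonneg (sub_nonneg.2 ht.2.le) hba.le]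
    refine (hM _ hγ).trans ?_
    -- `q` is chosen so that `Y ≤ q * l ^ α`. It can be less than `1`, so `1 + q` takes its place:
    -- the scaling inequality for `ω` needs a factor at most `1`.
    set q := a ^ s * b * l ^ (-s - 1) with hq_def
    have hq : 0 < q := by positivity
    have hXY : (1 + q)⁻¹ * ω Y ≤ ω (bdryDist (z + t • (w - z)) ^ α) := by
      refine hω.mul_le_of_mul_le (by positivity) (inv_le_one_of_one_le₀ (by linarith)) hY ?_
      have hα0 : 0 ≤ α := by linarith
      refine le_trans ?_ (Real.rpow_le_rpow hl.le hL hα0)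
      rw [inv_mul_le_iff₀ (by positivity)]
      have e1 : b ^ (α - s) ≤ b / l * l ^ (α - s) := by
        have h1 : (b / l) ^ (α - s) ≤ b / l := by
          have := Real.rpow_le_rpow_of_exponent_le (x := b / l) ((one_le_div hl).2 hlb)
            (show α - s ≤ 1 by linarith)
          rwa [Real.rpow_one] at this
        rw [Real.div_rpow hb.le hl.le, div_le_iff₀ (by positivity)] at h1
        exact h1
      have e2 : q * l ^ α = a ^ s * (b / l * l ^ (α - s)) := by
        have h3 : l ^ (-s - 1) * l ^ α = l ^ (α - s) / l := by
          rw [← Real.rpow_add hl, show -s - 1 + α = (α - s) - 1 by ring, Real.rpow_sub_one hl.ne']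
        rw [hq_def, mul_assoc, h3]
        ring
      calc Y ≤ a ^ s * (b / l * l ^ (α - s)) := by rw [hY_def]; gcongr
        _ = q * l ^ α := e2.symm
        _ ≤ (1 + q) * l ^ α := by gcongr; linarith
    calc M / ω (bdryDist (z + t • (w - z)) ^ α) ≤ M / ((1 + q)⁻¹ * ω Y) := by gcongr
      _ = M / ω Y * (1 + q) := by field_simp

theorem IsBlochType.hasWeightedLipschitzBound {ω : ℝ → ℝ} (hω : IsMajorant ω) {s α : ℝ}
    (hs0 : 0 < s) (hs1 : s < 1) (hα : s ≤ α) (hαs : α ≤ s + 1) {f : ℂ → ℂ}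
    (h : IsBlochType ω α f) : HasWeightedLipschitzBound ω s α f := by
  obtain ⟨M, hM0, hM⟩ := h.exists_norm_fderiv_le hω
  have h1s : 0 < 1 - s := by linarith
  refine ⟨M * (1 / (1 - s) + (1 + 1 / s)), by positivity, fun z hz w hw hne => ?_⟩
  have hY := hω.pos _ (mul_pos (Real.rpow_pos_of_pos (bdryDist_pos hz) s)
    (Real.rpow_pos_of_pos (bdryDist_pos hw) (α - s)))
  rw [div_le_iff₀ (norm_pos_iff.2 (sub_ne_zero.2 hne)), norm_sub_rev, norm_sub_rev z]
  rcases le_or_gt (bdryDist w) (bdryDist z) with hd | hd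
  · refine (norm_sub_le_of_bdryDist_ge hω hs0 hs1 hα h.1 hM0 hM hz hw hd).trans
      (mul_le_mul_of_nonneg_right ?_ (norm_nonneg _))
    rw [mul_div_right_comm]
    gcongr
    linarith [one_div_pos.2 hs0]
  · refine (norm_sub_le_of_bdryDist_lt hω hs0 hs1 hα hαs h.1 hM0 hM hz hw hd).trans
      (mul_le_mul_of_nonneg_right ?_ (norm_nonneg _))
    rw [mul_div_right_comm]
    exact mul_le_mul_of_nonneg_left (by linarith [one_div_pos.2 h1s]) (by positivity)

/-! ### From the Bloch bound to the mean oscillation bound. -/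

/-- On the radius towards `w` one has `d ≥ r (1 - t x)` with `x = ‖w - z‖ / r`, which costs `(1 - t
x) ^ (-α)`. Raising the exponent to some `β > 1` avoids the logarithm that arises at `α = 1`. -/
theorem norm_sub_le_of_mem_ball {ω : ℝ → ℝ} (hω : IsMajorant ω) {α M : ℝ} (hα : 1 ≤ α)
    {f : ℂ → ℂ} (hf : ContDiffOn ℝ 1 f unitDisk) (hM0 : 0 < M)
    (hM : ∀ z ∈ unitDisk, ‖fderiv ℝ f z‖ ≤ M / ω (bdryDist z ^ α))
    {z w : ℂ} (hz : z ∈ unitDisk) {r β : ℝ} (hr : r ∈ Ioc 0 (bdryDist z)) (hβ : 1 < β)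
    (hαβ : α ≤ β) (hw : w ∈ Metric.ball z r) :
    ‖f w - f z‖ ≤ M * r / (ω (r ^ α) * (β - 1)) * (1 - ‖w - z‖ / r) ^ (1 - β) := by
  have hr0 : 0 < r := hr.1
  have hωr := hω.pos _ (Real.rpow_pos_of_pos hr0 α)
  have hwD := ball_subset_unitDisk hz hr.2 hw
  have hβ' : 0 < β - 1 := by linarith
  rw [Metric.mem_ball, dist_eq_norm] at hw
  rcases eq_or_ne w z with rfl | hne
  · simp
    positivity
  have hρ : 0 < ‖w - z‖ := norm_pos_iff.2 (sub_ne_zero.2 hne)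
  set x := ‖w - z‖ / r with hx_def
  have hx : 0 < x := by positivity
  have hx1 : x < 1 := (div_lt_one hr0).2 hw
  have hpos : ∀ t ∈ Icc (0 : ℝ) 1, 0 < 1 - t * x := fun t ht => by nlinarith [ht.1, ht.2]
  have hderiv : ∀ t ∈ Icc (0 : ℝ) 1, HasDerivAt
      (fun t => M / ω (r ^ α) * ((1 - t * x) ^ (1 - β) / ((β - 1) * x)))
      (M / ω (r ^ α) * (1 - t * x) ^ (-β)) t := by
    intro t ht
    have h := (((((hasDerivAt_id t).mul_const x).const_sub 1).rpow_const (p := 1 - β)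
      (Or.inl (hpos t ht).ne')).div_const ((β - 1) * x)).const_mul (M / ω (r ^ α))
    refine h.congr_deriv ?_
    simp only [id]
    rw [show (1 - β - 1 : ℝ) = -β by ring]
    field_simp
    ring
  -- The antiderivative need not vanish at `0`. Its denominator `x` cancels against `‖w - z‖ = x *
  -- r`.
  have key := norm_sub_le_of_norm_fderiv_segment_le hf hz hwD
    (B := fun t => M / ω (r ^ α) * ((1 - t * x) ^ (1 - β) / ((β - 1) * x)))
    (by simp; positivity) (fun t ht => (hderiv t ht).continuousAt.continuousWithinAt)
    (fun t ht => hderiv t (Ico_subset_Icc_self ht)) ?_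
  · refine key.trans_eq ?_
    have : ‖w - z‖ = x * r := by rw [hx_def]; field_simp
    rw [this, one_mul]
    field_simp
  · intro t ht
    have ht' := Ico_subset_Icc_self ht
    have hp := hpos t ht'
    have hγ := add_smul_sub_mem_unitDisk hz hwD ht'
    have hd : r * (1 - t * x) ≤ bdryDist (z + t • (w - z)) := by
      have h1 := bdryDist_le_add_dist hz hγ
      have h2 : ‖z - (z + t • (w - z))‖ = r * (t * x) := by
        rw [sub_add_cancel_left, norm_neg, norm_smul, Real.norm_of_nonneg ht.1, hx_def]
        field_simp
      linarith [hr.2]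
    refine (hM _ hγ).trans ?_
    have hc1 : 1 - t * x ≤ 1 := by linarith [mul_nonneg ht.1 hx.le]
    have hXY : (1 - t * x) ^ α * ω (r ^ α) ≤ ω (bdryDist (z + t • (w - z)) ^ α) := by
      refine hω.mul_le_of_mul_le (by positivity) (Real.rpow_le_one hp.le hc1 (by linarith))
        (by positivity) ?_
      rw [← Real.mul_rpow hp.le hr0.le, mul_comm]
      exact Real.rpow_le_rpow (by positivity) hd (by linarith)
    calc M / ω (bdryDist (z + t • (w - z)) ^ α) ≤ M / ((1 - t * x) ^ α * ω (r ^ α)) := by gcongr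
      _ = M / ω (r ^ α) * (1 - t * x) ^ (-α) := by rw [Real.rpow_neg hp.le]; field_simp
      _ ≤ M / ω (r ^ α) * (1 - t * x) ^ (-β) := by
        gcongr ?_ * ?_
        exact Real.rpow_le_rpow_of_exponent_ge hp hc1 (by linarith)

theorem integrableOn_and_setIntegral_le_one_sub_norm_div_rpow {γ r : ℝ}
    (hγ : γ < 1) (hr : 0 < r) (z : ℂ) :
    IntegrableOn (fun w : ℂ => (1 - ‖w - z‖ / r) ^ (-γ)) (Metric.ball z r) ∧
    ∫ w in Metric.ball z r, (1 - ‖w - z‖ / r) ^ (-γ) ≤ 2 * Real.pi * r ^ 2 / (1 - γ) := by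
  set φ : ℝ → ℝ := (Iio r).indicator fun y => (1 - y / r) ^ (-γ) with hφ
  have hind : ∀ w : ℂ, (Metric.ball z r).indicator (fun w : ℂ => (1 - ‖w - z‖ / r) ^ (-γ)) w
      = φ ‖w - z‖ := by
    intro w
    simp only [hφ, indicator, Metric.mem_ball, dist_eq_norm, mem_Iio]
  have hint1 : IntervalIntegrable (fun y : ℝ => (1 - y / r) ^ (-γ)) volume 0 r := by
    have h := (intervalIntegral.intervalIntegrable_rpow' (a := 0) (b := 1) (r := -γ)
      (by linarith)).comp_sub_left (c := 1)
    have h2 := (h.comp_mul_right (c := r⁻¹))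
    simpa [div_eq_mul_inv, hr.ne'] using h2.symm
  have hint2 : ∫ y in (0 : ℝ)..r, (1 - y / r) ^ (-γ) = r / (1 - γ) := by
    rw [intervalIntegral.integral_comp_sub_div (fun y : ℝ => y ^ (-γ)) hr.ne' 1,
      integral_rpow (Or.inl (by linarith))]
    have : (0 : ℝ) ^ (-γ + 1) = 0 := Real.zero_rpow (by linarith)
    simp [hr.ne', this]
    rw [show -γ + 1 = 1 - γ by ring, div_eq_mul_inv]
  have hint3 : IntegrableOn (fun y : ℝ => (1 - y / r) ^ (-γ)) (Ioo 0 r) :=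
    ((intervalIntegrable_iff_integrableOn_Ioo_of_le hr.le).1 hint1)
  have hset : Ioi (0 : ℝ) ∩ Iio r = Ioo 0 r := rfl
  have hprod : IntegrableOn (fun y : ℝ => y * (1 - y / r) ^ (-γ)) (Ioo 0 r) := by
    refine Integrable.bdd_mul (c := r) hint3 (by fun_prop) ?_
    filter_upwards [ae_restrict_mem measurableSet_Ioo] with y hy
    rw [Real.norm_of_nonneg hy.1.le]
    exact hy.2.le
  have hmul : ∀ y, y ^ (Module.finrank ℝ ℂ - 1) • φ y
      = (Iio r).indicator (fun y => y * (1 - y / r) ^ (-γ)) y := by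
    intro y
    simp only [Complex.finrank_real_complex, hφ, indicator]
    split_ifs <;> simp
  constructor
  · rw [← integrable_indicator_iff measurableSet_ball, funext hind]
    refine Integrable.comp_sub_right (f := fun w : ℂ => φ ‖w‖) ?_ z
    rw [integrable_fun_norm_addHaar]
    simp_rw [hmul]
    rw [integrableOn_indicator_iff measurableSet_Iio, inter_comm, hset]
    exact hprod
  · rw [← integral_indicator measurableSet_ball, funext hind,
      integral_sub_right_eq_self (fun w : ℂ => φ ‖w‖) z, integral_fun_norm_addHaar]
    simp_rw [hmul]
    rw [setIntegral_indicator measurableSet_Iio, hset]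
    -- The Jacobian factor `y` is bounded by `r`.
    have h1 : ∫ y in Ioo 0 r, y * (1 - y / r) ^ (-γ) ≤ r * (r / (1 - γ)) := by
      rw [← hint2, intervalIntegral.integral_of_le hr.le, integral_Ioc_eq_integral_Ioo,
        ← integral_const_mul]
      refine setIntegral_mono_on hprod (hint3.const_mul r) measurableSet_Ioo fun y hy => ?_
      have : 0 ≤ 1 - y / r := by
        rw [sub_nonneg, div_le_one hr]
        exact hy.2.le
      have := hy.2
      gcongr
    have hvol : volume.real (Metric.ball (0 : ℂ) 1) = Real.pi := by
      simp [Measure.real]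
    rw [hvol, Complex.finrank_real_complex]
    simp only [smul_eq_mul, nsmul_eq_mul, Nat.cast_ofNat]
    calc 2 * (Real.pi * ∫ y in Ioo 0 r, y * (1 - y / r) ^ (-γ))
        ≤ 2 * (Real.pi * (r * (r / (1 - γ)))) := by gcongr
      _ = _ := by ring

theorem toReal_volume_ball_complex (z : ℂ) {r : ℝ} (hr : 0 ≤ r) :
    (volume (Metric.ball z r)).toReal = Real.pi * r ^ 2 := by
  simp [Complex.volume_ball, hr, mul_comm]

theorem IsBlochType.hasMeanOscillationBound {ω : ℝ → ℝ} (hω : IsMajorant ω) {α : ℝ}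
    (hα1 : 1 ≤ α) (hα2 : α < 2) {f : ℂ → ℂ} (h : IsBlochType ω α f) :
    HasMeanOscillationBound ω α f := by
  obtain ⟨M, hM0, hM⟩ := h.exists_norm_fderiv_le hω
  -- The exponent is `β = 1 + γ`: `β ≥ α` and integrability of `(1 - x) ^ (-γ)` at the rim both
  -- follow from `α < 2`.
  set γ := α / 2 with hγ
  have hγ0 : 0 < γ := by positivity
  have hγ1 : 0 < 1 - γ := by linarith
  refine ⟨M / γ * (2 / (1 - γ)), by positivity, fun z hz r hr => ?_⟩
  have hr0 : 0 < r := hr.1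
  have hωr := hω.pos _ (Real.rpow_pos_of_pos hr0 α)
  obtain ⟨hi, hle⟩ := integrableOn_and_setIntegral_le_one_sub_norm_div_rpow (γ := γ)
    (by linarith) hr0 z
  have hmono : ∫ ζ in Metric.ball z r, ‖f ζ - f z‖ ≤
      M * r / (ω (r ^ α) * γ) * (2 * Real.pi * r ^ 2 / (1 - γ)) := by
    refine le_trans (integral_mono_of_nonneg (Filter.Eventually.of_forall fun _ => norm_nonneg _)
      (hi.const_mul (M * r / (ω (r ^ α) * γ))) ?_) ?_
    · filter_upwards [ae_restrict_mem measurableSet_ball] with w hw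
      have := norm_sub_le_of_mem_ball hω hα1 h.1 hM0 hM hz (β := 1 + γ) hr (by linarith)
        (by linarith) hw
      rwa [show 1 - (1 + γ) = -γ by ring, show 1 + γ - 1 = γ by ring] at this
    · rw [integral_const_mul]
      gcongr
  rw [toReal_volume_ball_complex z hr0.le]
  calc 1 / (Real.pi * r ^ 2) * ∫ ζ in Metric.ball z r, ‖f ζ - f z‖
      ≤ 1 / (Real.pi * r ^ 2) * (M * r / (ω (r ^ α) * γ) * (2 * Real.pi * r ^ 2 / (1 - γ))) := by
        gcongr
    _ = _ := by field_simp

/-! ### Fourier coefficients on circles and Wirtinger derivatives. -/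

/-- The unit vector `cos θ + i sin θ`. -/
noncomputable def circleDir (θ : ℝ) : ℂ := (Real.cos θ : ℂ) + (Real.sin θ : ℂ) * Complex.I

/-- The weight `cos θ - c sin θ`, equal to `exp (-cθ)` when `c ^ 2 = -1`. -/
noncomputable def circleWeight (c : ℂ) (θ : ℝ) : ℂ := (Real.cos θ : ℂ) - c * (Real.sin θ : ℂ)

/-- The operator `∂₁ - c ∂₂`; for `c = ± i` it is twice a Wirtinger derivative. -/
noncomputable def wirtinger (c : ℂ) (f : ℂ → ℂ) (z : ℂ) : ℂ :=
  fderiv ℝ f z 1 - c * fderiv ℝ f z Complex.I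

@[fun_prop]
theorem continuous_circleDir : Continuous circleDir := by
  unfold circleDir
  fun_prop

@[fun_prop]
theorem continuous_circleWeight (c : ℂ) : Continuous (circleWeight c) := by
  unfold circleWeight
  fun_prop

theorem norm_circleDir (θ : ℝ) : ‖circleDir θ‖ = 1 := by
  rw [circleDir, Complex.ofReal_cos, Complex.ofReal_sin, ← Complex.exp_mul_I,
    Complex.norm_exp_ofReal_mul_I]

theorem norm_circleWeight {c : ℂ} (hc : c = Complex.I ∨ c = -Complex.I) (θ : ℝ) :
    ‖circleWeight c θ‖ = 1 := by
  rcases hc with rfl | rfl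
  · have : circleWeight Complex.I θ = circleDir (-θ) := by
      simp [circleWeight, circleDir]
      ring
    rw [this, norm_circleDir]
  · have : circleWeight (-Complex.I) θ = circleDir θ := by
      simp [circleWeight, circleDir]
      ring
    rw [this, norm_circleDir]

theorem hasDerivAt_circleDir (θ : ℝ) :
    HasDerivAt circleDir (Complex.I * circleDir θ) θ := by
  have h := (Real.hasDerivAt_cos θ).ofReal_comp.add
    ((Real.hasDerivAt_sin θ).ofReal_comp.mul_const Complex.I)
  refine h.congr_deriv ?_
  rw [circleDir, Complex.ofReal_neg]
  linear_combination (-(Real.sin θ : ℂ)) * Complex.I_sq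

theorem hasDerivAt_mul_circleWeight {c : ℂ} (hc : c ^ 2 = -1) (θ : ℝ) :
    HasDerivAt (fun θ => c * circleWeight c θ) (circleWeight c θ) θ := by
  have h := ((Real.hasDerivAt_cos θ).ofReal_comp.sub
    ((Real.hasDerivAt_sin θ).ofReal_comp.const_mul c)).const_mul c
  refine h.congr_deriv ?_
  rw [circleWeight, Complex.ofReal_neg]
  linear_combination (-(Real.cos θ : ℂ)) * hc

theorem integral_circleWeight (c : ℂ) : ∫ θ in -Real.pi..Real.pi, circleWeight c θ = 0 := by
  simp only [circleWeight]
  rw [intervalIntegral.integral_sub (Continuous.intervalIntegrable (by fun_prop) _ _)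
    (Continuous.intervalIntegrable (by fun_prop) _ _), intervalIntegral.integral_const_mul,
    intervalIntegral.integral_ofReal, intervalIntegral.integral_ofReal]
  simp

theorem circleDir_eq_smul (θ : ℝ) :
    circleDir θ = Real.cos θ • (1 : ℂ) + Real.sin θ • Complex.I := by
  simp [circleDir]

theorem I_mul_circleDir_eq_smul (θ : ℝ) :
    Complex.I * circleDir θ = -Real.sin θ • (1 : ℂ) + Real.cos θ • Complex.I := by
  simp only [circleDir, Complex.real_smul, Complex.ofReal_neg]
  linear_combination (Real.sin θ : ℂ) * Complex.I_sq

theorem map_circleDir (L : ℂ →L[ℝ] ℂ) (θ : ℝ) :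
    L (circleDir θ) = Real.cos θ * L 1 + Real.sin θ * L Complex.I := by
  rw [circleDir_eq_smul, map_add, map_smul, map_smul, Complex.real_smul, Complex.real_smul]

theorem map_I_mul_circleDir (L : ℂ →L[ℝ] ℂ) (θ : ℝ) :
    L (Complex.I * circleDir θ) = -Real.sin θ * L 1 + Real.cos θ * L Complex.I := by
  rw [I_mul_circleDir_eq_smul, map_add, map_smul, map_smul, Complex.real_smul, Complex.real_smul]
  push_cast
  rfl

theorem add_smul_circleDir_mem_ball {z : ℂ} {r ρ : ℝ} (hρ : |ρ| < r) (θ : ℝ) :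
    z + ρ • circleDir θ ∈ Metric.ball z r := by
  simpa [norm_smul, norm_circleDir] using hρ

theorem continuous_comp_circle {E : Type*} [TopologicalSpace E] {h : ℂ → E} {z : ℂ} {r ρ : ℝ}
    (hh : ContinuousOn h (Metric.ball z r)) (hρ : |ρ| < r) :
    Continuous fun θ => h (z + ρ • circleDir θ) :=
  hh.comp_continuous (by fun_prop) (add_smul_circleDir_mem_ball hρ)

theorem continuousOn_fderiv_ball {h : ℂ → ℂ} {z : ℂ} {r : ℝ}
    (hh : ContDiffOn ℝ 1 h (Metric.ball z r)) : ContinuousOn (fderiv ℝ h) (Metric.ball z r) :=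
  hh.continuousOn_fderiv_of_isOpen Metric.isOpen_ball le_rfl

theorem hasFDerivAt_of_mem_ball {h : ℂ → ℂ} {z w : ℂ} {r : ℝ}
    (hh : ContDiffOn ℝ 1 h (Metric.ball z r)) (hw : w ∈ Metric.ball z r) :
    HasFDerivAt h (fderiv ℝ h w) w :=
  ((hh.differentiableOn one_ne_zero).differentiableAt
    (Metric.isOpen_ball.mem_nhds hw)).hasFDerivAt

/-- Differentiation under the integral sign, dominated on a closed ball of intermediate radius `R`.
Negative `ρ` is allowed, so the derivative at `ρ = 0` is two-sided. -/
theorem hasDerivAt_circle_integral {h : ℂ → ℂ} {z : ℂ} {r ρ : ℝ}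
    (hh : ContDiffOn ℝ 1 h (Metric.ball z r)) (hρ : |ρ| < r) {k : ℝ → ℂ} (hk : Continuous k) :
    HasDerivAt (fun ρ : ℝ => ∫ θ in -Real.pi..Real.pi, k θ * h (z + ρ • circleDir θ))
      (∫ θ in -Real.pi..Real.pi, k θ * fderiv ℝ h (z + ρ • circleDir θ) (circleDir θ)) ρ := by
  obtain ⟨R, hρR, hRr⟩ := exists_between hρ
  obtain ⟨K, hK⟩ := (isCompact_closedBall z R).exists_bound_of_continuousOn
    ((continuousOn_fderiv_ball hh).mono (Metric.closedBall_subset_ball hRr))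
  have hs : Ioo (-R) R ∈ nhds ρ := Ioo_mem_nhds (abs_lt.1 hρR).1 (abs_lt.1 hρR).2
  have habs : ∀ x ∈ Ioo (-R) R, |x| < R := fun x hx => abs_lt.2 hx
  have hF : ∀ x ∈ Ioo (-R) R, Continuous fun θ => k θ * h (z + x • circleDir θ) := fun x hx =>
    hk.mul (continuous_comp_circle hh.continuousOn ((habs x hx).trans hRr))
  have hF' : Continuous fun θ => k θ * fderiv ℝ h (z + ρ • circleDir θ) (circleDir θ) :=
    hk.mul ((continuous_comp_circle (continuousOn_fderiv_ball hh) hρ).clm_apply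
      continuous_circleDir)
  refine (intervalIntegral.hasDerivAt_integral_of_dominated_loc_of_deriv_le hs
    (F' := fun x θ => k θ * fderiv ℝ h (z + x • circleDir θ) (circleDir θ))
    (bound := fun θ => ‖k θ‖ * K)
    (Filter.mem_of_superset hs fun x hx => (hF x hx).aestronglyMeasurable)
    ((hF ρ (abs_lt.1 hρR)).intervalIntegrable _ _) hF'.aestronglyMeasurable
    (Filter.Eventually.of_forall fun θ _ x hx => ?_)
    (Continuous.intervalIntegrable (by fun_prop) _ _)
    (Filter.Eventually.of_forall fun θ _ x hx => ?_)).2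
  · rw [norm_mul]
    gcongr
    refine (ContinuousLinearMap.le_opNorm _ _).trans ?_
    rw [norm_circleDir, mul_one]
    exact hK _ (Metric.ball_subset_closedBall (add_smul_circleDir_mem_ball (habs x hx) θ))
  · have h2 : HasDerivAt (fun x : ℝ => z + x • circleDir θ) (circleDir θ) x := by
      simpa using ((hasDerivAt_id x).smul_const (circleDir θ)).const_add z
    exact ((hasFDerivAt_of_mem_ball hh (add_smul_circleDir_mem_ball
      ((habs x hx).trans hRr) θ)).comp_hasDerivAt x h2).const_mul _

theorem integral_circle_by_parts {h : ℂ → ℂ} {z : ℂ} {r ρ : ℝ}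
    (hh : ContDiffOn ℝ 1 h (Metric.ball z r)) (hρ : |ρ| < r) {κ κ' : ℝ → ℂ}
    (hκ : ∀ θ, HasDerivAt κ (κ' θ) θ) (hκ' : Continuous κ') (hper : κ (-Real.pi) = κ Real.pi) :
    ρ * (∫ θ in -Real.pi..Real.pi,
        κ θ * fderiv ℝ h (z + ρ • circleDir θ) (Complex.I * circleDir θ)) +
      ∫ θ in -Real.pi..Real.pi, κ' θ * h (z + ρ • circleDir θ) = 0 := by
  have hκc : Continuous κ := continuous_iff_continuousAt.2 fun θ => (hκ θ).continuousAt
  have hD := continuous_comp_circle (continuousOn_fderiv_ball hh) hρ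
  have hc := continuous_comp_circle hh.continuousOn hρ
  have hderiv : ∀ θ, HasDerivAt (fun θ => κ θ * h (z + ρ • circleDir θ))
      (ρ * (κ θ * fderiv ℝ h (z + ρ • circleDir θ) (Complex.I * circleDir θ)) +
        κ' θ * h (z + ρ • circleDir θ)) θ := by
    intro θ
    have h2 : HasDerivAt (fun θ => z + ρ • circleDir θ) (ρ • (Complex.I * circleDir θ)) θ :=
      ((hasDerivAt_circleDir θ).const_smul ρ).const_add z
    refine ((hκ θ).mul ((hasFDerivAt_of_mem_ball hh
      (add_smul_circleDir_mem_ball hρ θ)).comp_hasDerivAt θ h2)).congr_deriv ?_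
    rw [map_smul, Complex.real_smul]
    simp only [Function.comp]
    ring
  have hc1 : Continuous fun θ =>
      (ρ : ℂ) * (κ θ * fderiv ℝ h (z + ρ • circleDir θ) (Complex.I * circleDir θ)) :=
    continuous_const.mul (hκc.mul (hD.clm_apply (by fun_prop)))
  have hc2 : Continuous fun θ => κ' θ * h (z + ρ • circleDir θ) := hκ'.mul hc
  rw [← intervalIntegral.integral_const_mul, ← intervalIntegral.integral_add
    (hc1.intervalIntegrable _ _) (hc2.intervalIntegrable _ _),
    intervalIntegral.integral_eq_sub_of_hasDerivAt (fun θ _ => hderiv θ)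
      ((hc1.add hc2).intervalIntegrable _ _)]
  have : circleDir (-Real.pi) = circleDir Real.pi := by simp [circleDir]
  rw [hper, this, sub_self]

/-- The product rule leaves a term without derivatives of `f`. Since `c * circleWeight c` is an
antiderivative of `circleWeight c`, integration by parts turns it into a tangential derivative, and
the radial and tangential parts combine to `∂₁ - c ∂₂`. -/
theorem hasDerivAt_mul_circle_coeff {f : ℂ → ℂ} {z c : ℂ} {r ρ : ℝ} (hc : c ^ 2 = -1)
    (hf : ContDiffOn ℝ 1 f (Metric.ball z r)) (hρ : |ρ| < r) :
    HasDerivAt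
      (fun ρ : ℝ => (ρ : ℂ) *
        ∫ θ in -Real.pi..Real.pi, circleWeight c θ * f (z + ρ • circleDir θ))
      (ρ * ∫ θ in -Real.pi..Real.pi, wirtinger c f (z + ρ • circleDir θ)) ρ := by
  have h1 := (hasDerivAt_id ρ).ofReal_comp.mul
    (hasDerivAt_circle_integral hf hρ (continuous_circleWeight c))
  refine h1.congr_deriv ?_
  have h2 := integral_circle_by_parts hf hρ (hasDerivAt_mul_circleWeight hc)
    (continuous_circleWeight c) (by simp [circleWeight])
  have hD := continuous_comp_circle (continuousOn_fderiv_ball hf) hρ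
  have hsub : ∫ θ in -Real.pi..Real.pi, wirtinger c f (z + ρ • circleDir θ) =
      (∫ θ in -Real.pi..Real.pi,
        circleWeight c θ * fderiv ℝ f (z + ρ • circleDir θ) (circleDir θ)) -
      ∫ θ in -Real.pi..Real.pi,
        c * circleWeight c θ * fderiv ℝ f (z + ρ • circleDir θ) (Complex.I * circleDir θ) := by
    rw [← intervalIntegral.integral_sub]
    · refine intervalIntegral.integral_congr fun θ _ => ?_
      have hsc : (Real.cos θ : ℂ) ^ 2 + (Real.sin θ : ℂ) ^ 2 = 1 := by
        exact_mod_cast Real.cos_sq_add_sin_sq θ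
      simp only [wirtinger, circleWeight, map_circleDir, map_I_mul_circleDir]
      set A := fderiv ℝ f (z + ρ • circleDir θ) 1
      set B := fderiv ℝ f (z + ρ • circleDir θ) Complex.I
      linear_combination (-(A - c * B)) * hsc +
        (((Real.sin θ : ℂ) ^ 2 * A - (Real.sin θ * Real.cos θ : ℂ) * B)) * hc
    · exact (((continuous_circleWeight c).mul
        (hD.clm_apply continuous_circleDir))).intervalIntegrable _ _
    · exact Continuous.intervalIntegrable ((continuous_const.mul (continuous_circleWeight c)).mul
        (hD.clm_apply (continuous_const.mul continuous_circleDir))) _ _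
  rw [hsub]
  simp only [id, Complex.ofReal_one, one_mul]
  linear_combination h2

/-- The tangential derivative has mean zero on the circle. Adding `c` times it to the radial
derivative produces a unimodular weight times `wirtinger (-c) U`. -/
theorem norm_deriv_circle_mean_le {U : ℂ → ℂ} {z c : ℂ} {r ρ G : ℝ}
    (hc : c = Complex.I ∨ c = -Complex.I)
    (hU : ContDiffOn ℝ 1 U (Metric.ball z r))
    (hG : ∀ w ∈ Metric.ball z r, ‖wirtinger (-c) U w‖ ≤ G) (hρ : |ρ| < r) :
    ‖∫ θ in -Real.pi..Real.pi, fderiv ℝ U (z + ρ • circleDir θ) (circleDir θ)‖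
      ≤ 2 * Real.pi * G := by
  have hc2 : c ^ 2 = -1 := by rcases hc with rfl | rfl <;> simp
  have hD := continuous_comp_circle (continuousOn_fderiv_ball hU) hρ
  have hG0 : 0 ≤ G := (norm_nonneg _).trans
    (hG z (Metric.mem_ball_self ((abs_nonneg ρ).trans_lt hρ)))
  have hadd : (∫ θ in -Real.pi..Real.pi, fderiv ℝ U (z + ρ • circleDir θ) (circleDir θ)) +
      (∫ θ in -Real.pi..Real.pi, c * fderiv ℝ U (z + ρ • circleDir θ) (Complex.I * circleDir θ)) =
      ∫ θ in -Real.pi..Real.pi, circleWeight c θ * wirtinger (-c) U (z + ρ • circleDir θ) := by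
    rw [← intervalIntegral.integral_add]
    · refine intervalIntegral.integral_congr fun θ _ => ?_
      simp only [wirtinger, circleWeight, map_circleDir, map_I_mul_circleDir]
      set A := fderiv ℝ U (z + ρ • circleDir θ) 1
      set B := fderiv ℝ U (z + ρ • circleDir θ) Complex.I
      linear_combination ((Real.sin θ : ℂ) * B) * hc2
    · exact (hD.clm_apply continuous_circleDir).intervalIntegrable _ _
    · exact Continuous.intervalIntegrable (continuous_const.mul
        (hD.clm_apply (continuous_const.mul continuous_circleDir))) _ _
  have hzero : ∫ θ in -Real.pi..Real.pi,
      c * fderiv ℝ U (z + ρ • circleDir θ) (Complex.I * circleDir θ) = 0 := by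
    -- Integration by parts carries a factor `ρ`, so at the centre the mean is computed directly
    -- from the means of `cos` and `sin`.
    rcases eq_or_ne ρ 0 with rfl | h0
    · have hk : ∀ θ, fderiv ℝ U z (Complex.I * circleDir θ) =
          (Real.cos θ : ℂ) * fderiv ℝ U z Complex.I - (Real.sin θ : ℂ) * fderiv ℝ U z 1 := by
        intro θ
        rw [map_I_mul_circleDir]
        ring
      simp only [zero_smul, add_zero, hk, intervalIntegral.integral_const_mul]
      rw [intervalIntegral.integral_sub (Continuous.intervalIntegrable (by fun_prop) _ _)
        (Continuous.intervalIntegrable (by fun_prop) _ _), intervalIntegral.integral_mul_const,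
        intervalIntegral.integral_mul_const, intervalIntegral.integral_ofReal,
        intervalIntegral.integral_ofReal]
      simp
    · have h := integral_circle_by_parts hU hρ (κ := fun _ => c) (κ' := fun _ => 0)
        (fun θ => hasDerivAt_const _ _) continuous_const rfl
      simpa [h0] using h
  rw [hzero, add_zero] at hadd
  rw [hadd]
  refine (intervalIntegral.norm_integral_le_of_norm_le_const (C := G) fun θ _ => ?_).trans_eq ?_
  · rw [norm_mul, norm_circleWeight hc, one_mul]
    exact hG _ (add_smul_circleDir_mem_ball hρ θ)
  · rw [abs_of_nonneg (by linarith [Real.pi_pos])]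
    ring

theorem norm_circle_mean_sub_le {U : ℂ → ℂ} {z c : ℂ} {r ρ G : ℝ}
    (hc : c = Complex.I ∨ c = -Complex.I) (hU : ContDiffOn ℝ 1 U (Metric.ball z r))
    (hG : ∀ w ∈ Metric.ball z r, ‖wirtinger (-c) U w‖ ≤ G) (hρ0 : 0 ≤ ρ) (hρ : ρ < r) :
    ‖(∫ θ in -Real.pi..Real.pi, U (z + ρ • circleDir θ)) - 2 * Real.pi * U z‖
      ≤ 2 * Real.pi * G * ρ := by
  have habs : ∀ x ∈ Icc 0 ρ, |x| < r := fun x hx => by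
    rw [abs_of_nonneg hx.1]
    exact hx.2.trans_lt hρ
  have hd : ∀ x ∈ Icc 0 ρ,
      HasDerivAt (fun ρ : ℝ => ∫ θ in -Real.pi..Real.pi, U (z + ρ • circleDir θ))
      (∫ θ in -Real.pi..Real.pi, fderiv ℝ U (z + x • circleDir θ) (circleDir θ)) x := fun x hx => by
    simpa using hasDerivAt_circle_integral hU (habs x hx) (continuous_const (y := (1 : ℂ)))
  have key := norm_image_sub_le_of_norm_deriv_right_le_segment (C := 2 * Real.pi * G)
    (fun x hx => (hd x hx).continuousAt.continuousWithinAt)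
    (fun x hx => (hd x (Ico_subset_Icc_self hx)).hasDerivWithinAt)
    (fun x hx => norm_deriv_circle_mean_le hc hU hG (habs x (Ico_subset_Icc_self hx)))
    ρ (right_mem_Icc.2 hρ0)
  have h0 : ∫ θ in -Real.pi..Real.pi, U (z + (0 : ℝ) • circleDir θ) = 2 * Real.pi * U z := by
    simp only [zero_smul, add_zero, intervalIntegral.integral_const, Complex.real_smul]
    push_cast
    ring
  rwa [h0, sub_zero] at key

theorem contDiffOn_wirtinger {f : ℂ → ℂ} {z : ℂ} {r : ℝ} (c : ℂ)
    (hf : ContDiffOn ℝ 2 f (Metric.ball z r)) :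
    ContDiffOn ℝ 1 (wirtinger c f) (Metric.ball z r) := by
  have h : ContDiffOn ℝ 1 (fderiv ℝ f) (Metric.ball z r) :=
    hf.fderiv_of_isOpen Metric.isOpen_ball (by norm_num)
  exact (h.clm_apply contDiffOn_const).sub
    (contDiffOn_const.mul (h.clm_apply contDiffOn_const))

/-- The mixed terms of `(∂₁ + c ∂₂)(∂₁ - c ∂₂)` cancel by symmetry of the second derivative, and `-c
^ 2 = 1`. -/
theorem wirtinger_neg_wirtinger {f : ℂ → ℂ} {z c : ℂ} (hc : c ^ 2 = -1)
    (hf : ContDiffAt ℝ 2 f z) :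
    wirtinger (-c) (wirtinger c f) z = Laplacian.laplacian f z := by
  have h : DifferentiableAt ℝ (fderiv ℝ f) z :=
    (hf.fderiv_right (m := 1) (by norm_num)).differentiableAt one_ne_zero
  have hsymm : IsSymmSndFDerivAt ℝ f z := hf.isSymmSndFDerivAt (by simp)
  have happ : ∀ v, HasFDerivAt (fun w => fderiv ℝ f w v)
      ((fderiv ℝ (fderiv ℝ f) z).flip v) z := fun v => by
    simpa using h.hasFDerivAt.clm_apply (hasFDerivAt_const v z)
  have hW : HasFDerivAt (wirtinger c f) ((fderiv ℝ (fderiv ℝ f) z).flip 1 -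
      c • (fderiv ℝ (fderiv ℝ f) z).flip Complex.I) z :=
    (happ 1).sub ((happ Complex.I).const_mul c)
  rw [wirtinger, hW.fderiv, InnerProductSpace.laplacian_eq_iteratedFDeriv_complexPlane]
  simp only [iteratedFDeriv_two_apply]
  have hs := hsymm.eq 1 Complex.I
  simp [hs]
  linear_combination (-(fderiv ℝ (fderiv ℝ f) z Complex.I Complex.I)) * hc

/-- Continuity on the closed ball makes the polar integrand continuous on a compact rectangle, hence
integrable, so Fubini applies. -/
theorem intervalIntegrable_and_setIntegral_ball_eq_polar {H : ℂ → ℝ} {z : ℂ} {r : ℝ} (hr : 0 < r)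
    (hH : ContinuousOn H (Metric.closedBall z r)) :
    IntervalIntegrable
      (fun ρ => ρ * ∫ θ in -Real.pi..Real.pi, H (z + ρ • circleDir θ)) volume 0 r ∧
    ∫ w in Metric.ball z r, H w =
      ∫ ρ in (0 : ℝ)..r, ρ * ∫ θ in -Real.pi..Real.pi, H (z + ρ • circleDir θ) := by
  have hpi : -Real.pi ≤ Real.pi := by linarith [Real.pi_pos]
  set Q : ℝ × ℝ → ℝ := fun p => p.1 * H (z + p.1 • circleDir p.2) with hQ
  have hcont : ContinuousOn Q (Icc 0 r ×ˢ Icc (-Real.pi) Real.pi) := by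
    refine continuousOn_fst.mul (hH.comp (by fun_prop) ?_)
    rintro ⟨ρ, θ⟩ ⟨h1, -⟩
    simp only [Metric.mem_closedBall, dist_self_add_left, norm_smul, norm_circleDir, mul_one,
      Real.norm_of_nonneg h1.1]
    exact h1.2
  have hint : IntegrableOn Q (Ioo 0 r ×ˢ Ioo (-Real.pi) Real.pi) (volume.prod volume) :=
    (hcont.integrableOn_compact (isCompact_Icc.prod isCompact_Icc)).mono_set
      (prod_mono Ioo_subset_Icc_self Ioo_subset_Icc_self)
  have hinner : ∀ ρ : ℝ, ∫ θ in Ioo (-Real.pi) Real.pi, Q (ρ, θ) =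
      ρ * ∫ θ in -Real.pi..Real.pi, H (z + ρ • circleDir θ) := by
    intro ρ
    rw [intervalIntegral.integral_of_le hpi, integral_Ioc_eq_integral_Ioo, ← integral_const_mul]
  constructor
  · rw [intervalIntegrable_iff_integrableOn_Ioo_of_le hr.le]
    have := hint
    rw [IntegrableOn, ← Measure.prod_restrict] at this
    exact this.integral_prod_left.congr (Filter.Eventually.of_forall hinner)
  · rw [← integral_indicator measurableSet_ball,
      ← integral_add_left_eq_self _ z, ← Complex.integral_comp_polarCoord_symm,
      intervalIntegral.integral_of_le hr.le, integral_Ioc_eq_integral_Ioo]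
    have hset : ∀ p ∈ polarCoord.target, p.1 • (Metric.ball z r).indicator H
        (z + Complex.polarCoord.symm p) =
        (Iio r ×ˢ univ).indicator Q p := by
      rintro ⟨ρ, θ⟩ hp
      have hρ : 0 < ρ := hp.1
      have hsymm : Complex.polarCoord.symm (ρ, θ) = ρ • circleDir θ := by
        rw [Complex.polarCoord_symm_apply, circleDir, Complex.real_smul]
      rw [hsymm]
      have hmem : z + ρ • circleDir θ ∈ Metric.ball z r ↔ (ρ, θ) ∈ Iio r ×ˢ (univ : Set ℝ) := by
        simp [norm_circleDir, abs_of_pos hρ]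
      by_cases h : z + ρ • circleDir θ ∈ Metric.ball z r
      · rw [indicator_of_mem h, indicator_of_mem (hmem.1 h), smul_eq_mul]
      · rw [indicator_of_notMem h, indicator_of_notMem (mt hmem.2 h), smul_zero]
    have hmt : MeasurableSet polarCoord.target := polarCoord.open_target.measurableSet
    rw [setIntegral_congr_fun hmt hset,
      setIntegral_indicator (measurableSet_Iio.prod MeasurableSet.univ)]
    have hinter : polarCoord.target ∩ Iio r ×ˢ (univ : Set ℝ) =
        Ioo 0 r ×ˢ Ioo (-Real.pi) Real.pi := by
      rw [polarCoord_target, prod_inter_prod, inter_univ]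
      rfl
    rw [hinter, Measure.volume_eq_prod, setIntegral_prod _ hint]
    exact integral_congr_ae (Filter.Eventually.of_forall hinner)

/-- The difference vanishes at `ρ = 0`, and its derivative is `ρ` times the deviation of the circle
integral of `wirtinger c f` from `2π` times its central value, hence at most `2πGρ²`. -/
theorem norm_circle_coeff_sub_le {f : ℂ → ℂ} {z c : ℂ} {r ρ G : ℝ}
    (hc : c = Complex.I ∨ c = -Complex.I) (hf : ContDiffOn ℝ 2 f (Metric.ball z r))
    (hG : ∀ w ∈ Metric.ball z r, ‖Laplacian.laplacian f w‖ ≤ G) (hρ0 : 0 ≤ ρ) (hρ : ρ < r) :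
    ‖(ρ : ℂ) * (∫ θ in -Real.pi..Real.pi, circleWeight c θ * f (z + ρ • circleDir θ)) -
      Real.pi * ρ ^ 2 * wirtinger c f z‖ ≤ 2 * Real.pi * G / 3 * ρ ^ 3 := by
  have hc2 : c ^ 2 = -1 := by rcases hc with rfl | rfl <;> simp
  have hU := contDiffOn_wirtinger c hf
  have hGU : ∀ w ∈ Metric.ball z r, ‖wirtinger (-c) (wirtinger c f) w‖ ≤ G := fun w hw => by
    rw [wirtinger_neg_wirtinger hc2 (hf.contDiffAt (Metric.isOpen_ball.mem_nhds hw))]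
    exact hG w hw
  have habs : ∀ x ∈ Icc 0 ρ, |x| < r := fun x hx => by
    rw [abs_of_nonneg hx.1]
    exact hx.2.trans_lt hρ
  have hd : ∀ x ∈ Icc 0 ρ, HasDerivAt (fun ρ : ℝ => (ρ : ℂ) *
      (∫ θ in -Real.pi..Real.pi, circleWeight c θ * f (z + ρ • circleDir θ)) -
      Real.pi * ρ ^ 2 * wirtinger c f z)
      (x * ((∫ θ in -Real.pi..Real.pi, wirtinger c f (z + x • circleDir θ)) -
        2 * Real.pi * wirtinger c f z)) x := by
    intro x hx
    have h1 := hasDerivAt_mul_circle_coeff hc2 (hf.of_le one_le_two) (habs x hx)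
    have h2 := (((hasDerivAt_id x).ofReal_comp.pow 2).const_mul (Real.pi : ℂ)).mul_const
      (wirtinger c f z)
    refine (h1.sub h2).congr_deriv ?_
    simp
    ring
  refine image_norm_le_of_norm_deriv_right_le_deriv_boundary
    (fun x hx => (hd x hx).continuousAt.continuousWithinAt)
    (fun x hx => (hd x (Ico_subset_Icc_self hx)).hasDerivWithinAt)
    (B := fun x => 2 * Real.pi * G / 3 * x ^ 3) (B' := fun x => 2 * Real.pi * G * x ^ 2)
    (by simp) (fun x => ?_) (fun x hx => ?_) (right_mem_Icc.2 hρ0)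
  · refine ((hasDerivAt_pow 3 x).const_mul (2 * Real.pi * G / 3)).congr_deriv ?_
    norm_num
    ring
  · rw [norm_mul, Complex.norm_real, Real.norm_of_nonneg hx.1]
    have := norm_circle_mean_sub_le hc hU hGU hx.1 (hx.2.trans hρ)
    nlinarith [hx.1]

/-- Integrating the circle estimate over `0 < ρ < r` gives `π r³ / 3` times the left side, the area
integral of `‖f - f z‖`, and the error `π G r⁴ / 6`. -/
theorem norm_wirtinger_le {f : ℂ → ℂ} {z c : ℂ} {r G : ℝ} (hr : 0 < r)
    (hc : c = Complex.I ∨ c = -Complex.I) (hf : ContDiffOn ℝ 2 f (Metric.ball z r))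
    (hfc : ContinuousOn f (Metric.closedBall z r))
    (hG : ∀ w ∈ Metric.ball z r, ‖Laplacian.laplacian f w‖ ≤ G) :
    ‖wirtinger c f z‖ ≤
      3 / (Real.pi * r ^ 3) * (∫ w in Metric.ball z r, ‖f w - f z‖) + G * r / 2 := by
  have hpi : -Real.pi ≤ Real.pi := by linarith [Real.pi_pos]
  obtain ⟨hint, heq⟩ := intervalIntegrable_and_setIntegral_ball_eq_polar hr
    (H := fun w => ‖f w - f z‖) ((hfc.sub continuousOn_const).norm)
  have hpt : ∀ ρ ∈ Ioo 0 r, Real.pi * ‖wirtinger c f z‖ * ρ ^ 2 ≤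
      ρ * (∫ θ in -Real.pi..Real.pi, ‖f (z + ρ • circleDir θ) - f z‖) +
        2 * Real.pi * G / 3 * ρ ^ 3 := by
    intro ρ hρ
    have habs : |ρ| < r := by rw [abs_of_pos hρ.1]; exact hρ.2
    have h1 := norm_circle_coeff_sub_le hc hf hG hρ.1.le hρ.2
    have hfcirc := continuous_comp_circle hf.continuousOn habs
    have h2 : ‖∫ θ in -Real.pi..Real.pi, circleWeight c θ * f (z + ρ • circleDir θ)‖ ≤
        ∫ θ in -Real.pi..Real.pi, ‖f (z + ρ • circleDir θ) - f z‖ := by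
      -- The weight has mean zero, so subtracting the constant `f z` changes nothing.
      have h3 : ∫ θ in -Real.pi..Real.pi, circleWeight c θ * f (z + ρ • circleDir θ) =
          ∫ θ in -Real.pi..Real.pi, circleWeight c θ * (f (z + ρ • circleDir θ) - f z) := by
        have hk : Continuous fun θ => circleWeight c θ * f (z + ρ • circleDir θ) :=
          (continuous_circleWeight c).mul hfcirc
        simp only [mul_sub]
        rw [intervalIntegral.integral_sub (hk.intervalIntegrable _ _)
          (Continuous.intervalIntegrable (by fun_prop) _ _),
          intervalIntegral.integral_mul_const, integral_circleWeight, zero_mul, sub_zero]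
      rw [h3]
      refine (intervalIntegral.norm_integral_le_integral_norm hpi).trans_eq ?_
      simp only [norm_mul, norm_circleWeight hc, one_mul]
    have h4 : ‖(Real.pi : ℂ) * ρ ^ 2 * wirtinger c f z‖ =
        Real.pi * ‖wirtinger c f z‖ * ρ ^ 2 := by
      rw [norm_mul, norm_mul, norm_pow, Complex.norm_real, Complex.norm_real,
        Real.norm_of_nonneg Real.pi_pos.le, Real.norm_of_nonneg hρ.1.le]
      ring
    set X := ∫ θ in -Real.pi..Real.pi, circleWeight c θ * f (z + ρ • circleDir θ) with hX
    have h5 : ‖(ρ : ℂ) * X‖ = ρ * ‖X‖ := by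
      rw [norm_mul, Complex.norm_real, Real.norm_of_nonneg hρ.1.le]
    have h6 := norm_sub_norm_le ((Real.pi : ℂ) * ρ ^ 2 * wirtinger c f z) ((ρ : ℂ) * X)
    rw [norm_sub_rev, h4, h5] at h6
    linarith [mul_le_mul_of_nonneg_left h2 hρ.1.le]
  have hmono := intervalIntegral.integral_mono_on_of_le_Ioo hr.le
    (Continuous.intervalIntegrable (by fun_prop) _ _)
    (hint.add (Continuous.intervalIntegrable
      (u := fun ρ : ℝ => 2 * Real.pi * G / 3 * ρ ^ 3) (by fun_prop) _ _)) hpt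
  rw [intervalIntegral.integral_add hint (Continuous.intervalIntegrable (by fun_prop) _ _), ← heq,
    intervalIntegral.integral_const_mul, intervalIntegral.integral_const_mul, integral_pow,
    integral_pow] at hmono
  set J := ∫ w in Metric.ball z r, ‖f w - f z‖
  have hpr : 0 < Real.pi * r ^ 3 := by positivity
  norm_num at hmono
  rw [div_mul_eq_mul_div, ← sub_le_iff_le_add, le_div_iff₀ hpr]
  nlinarith

/-- The differential is `v ↦ f_z v + f_{z̄} v̄`, and the two operators are `2 f_z` and `2 f_{z̄}`;
the factor `1 / 2` is given away. -/
theorem norm_fderiv_le_wirtinger (f : ℂ → ℂ) (z : ℂ) :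
    ‖fderiv ℝ f z‖ ≤ ‖wirtinger Complex.I f z‖ + ‖wirtinger (-Complex.I) f z‖ := by
  refine ContinuousLinearMap.opNorm_le_bound _ (by positivity) fun v => ?_
  set L := fderiv ℝ f z
  have hv : v = v.re • (1 : ℂ) + v.im • Complex.I := by simp [Complex.re_add_im]
  have hL : L v = (1 / 2 : ℂ) * wirtinger Complex.I f z * v +
      (1 / 2 : ℂ) * wirtinger (-Complex.I) f z * (starRingEnd ℂ) v := by
    have h1 : L v = v.re * L 1 + v.im * L Complex.I := by
      conv_lhs => rw [hv]
      rw [map_add, map_smul, map_smul, Complex.real_smul, Complex.real_smul]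
    have h2 : (starRingEnd ℂ) v = v.re - v.im * Complex.I := by
      apply Complex.ext <;> simp
    have h3 : v = v.re + v.im * Complex.I := (Complex.re_add_im v).symm
    rw [h1, h2]
    conv_rhs => enter [1, 2]; rw [h3]
    simp only [wirtinger]
    linear_combination ((v.im : ℂ) * L Complex.I) * Complex.I_sq
  rw [hL]
  refine (norm_add_le _ _).trans ?_
  simp only [norm_mul, RCLike.norm_conj]
  norm_num
  nlinarith [norm_nonneg v, norm_nonneg (wirtinger Complex.I f z),
    norm_nonneg (wirtinger (-Complex.I) f z),
    mul_nonneg (norm_nonneg (wirtinger Complex.I f z)) (norm_nonneg v),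
    mul_nonneg (norm_nonneg (wirtinger (-Complex.I) f z)) (norm_nonneg v)]

/-! ### From the mean oscillation bound to the Bloch bound, and conclusion. -/

theorem HasMeanOscillationBound.isBlochType {ω : ℝ → ℝ} (hω : IsMajorant ω) {g f : ℂ → ℂ}
    (hg : ContinuousOn g (closure unitDisk)) (hf : IsPoissonSolution g f) {α : ℝ} (hα : 0 ≤ α)
    (h : HasMeanOscillationBound ω α f) : IsBlochType ω α f := by
  obtain ⟨C, hC, hb⟩ := h
  obtain ⟨G, hG⟩ : ∃ G, ∀ w ∈ closure unitDisk, ‖g w‖ ≤ G := by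
    rw [closure_unitDisk] at hg ⊢
    exact (isCompact_closedBall 0 1).exists_bound_of_continuousOn hg
  have hG0 : 0 ≤ G := (norm_nonneg _).trans (hG 0 (subset_closure (by simp [mem_unitDisk])))
  refine ⟨hf.contDiffOn.of_le one_le_two, 2 * (3 * C + G / 2 * ω 1), ?_⟩
  rintro _ ⟨z, hz, rfl⟩
  have hr := bdryDist_pos hz
  have hr1 := bdryDist_le_one hz
  set r := bdryDist z with hr_def
  have hωr := hω.pos _ (Real.rpow_pos_of_pos hr α)
  -- As `d(z) ≤ 1`, the Laplacian error `G r / 2` times `ω (r ^ α)` is at most the constant `G / 2 *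
  -- ω 1`.
  have hω1 : ω (r ^ α) ≤ ω 1 := hω.mono (by positivity) (Real.rpow_le_one hr.le hr1 hα)
  have hsub := ball_subset_unitDisk hz hr_def.le
  have hosc := hb z hz r ⟨hr, hr_def.le⟩
  rw [toReal_volume_ball_complex z hr.le, one_div_mul_eq_div, div_le_iff₀ (by positivity)] at hosc
  have hW : ∀ c : ℂ, c = Complex.I ∨ c = -Complex.I →
      ‖wirtinger c f z‖ * ω (r ^ α) ≤ 3 * C + G / 2 * ω 1 := by
    intro c hc
    have h1 := norm_wirtinger_le hr hc (hf.contDiffOn.mono hsub)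
      (hf.continuousOn.mono (closedBall_subset_closure_unitDisk hz hr_def.le))
      (G := G) fun w hw => by
        rw [hf.laplacian_eq w (hsub hw)]
        exact hG w (subset_closure (hsub hw))
    calc ‖wirtinger c f z‖ * ω (r ^ α)
        ≤ (3 / (Real.pi * r ^ 3) * (C * r / ω (r ^ α) * (Real.pi * r ^ 2)) + G * r / 2) *
          ω (r ^ α) := by
          refine mul_le_mul_of_nonneg_right (h1.trans ?_) hωr.le
          gcongr
      _ = 3 * C + G * r / 2 * ω (r ^ α) := by field_simp
      _ ≤ 3 * C + G * 1 / 2 * ω 1 := by gcongr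
      _ = _ := by rw [mul_one]
  show ‖fderiv ℝ f z‖ * ω (r ^ α) ≤ _
  calc ‖fderiv ℝ f z‖ * ω (r ^ α)
      ≤ (‖wirtinger Complex.I f z‖ + ‖wirtinger (-Complex.I) f z‖) * ω (r ^ α) :=
        mul_le_mul_of_nonneg_right (norm_fderiv_le_wirtinger f z) hωr.le
    _ ≤ _ := by linarith [hW _ (Or.inl rfl), hW _ (Or.inr rfl)]

theorem mainTheorem3 (ω : ℝ → ℝ) (hω : IsMajorant ω)
    (g : ℂ → ℂ) (hg : ContinuousOn g (closure unitDisk))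
    (f : ℂ → ℂ) (hf : IsPoissonSolution g f)
    (s α : ℝ) (hs0 : 0 ≤ s) (hs1 : s < 1) (hα1 : 1 ≤ α) (hαs : α ≤ s + 1) :
    (0 < s → List.TFAE
      [IsBlochType ω α f,
        HasMeanOscillationBound ω α f,
        HasWeightedLipschitzBound ω s α f]) ∧
    (s = 0 →
      (IsBlochType ω α f ↔ HasMeanOscillationBound ω α f) ∧
        (HasWeightedLipschitzBound ω s α f → IsBlochType ω α f)) := by
  have h12 : IsBlochType ω α f ↔ HasMeanOscillationBound ω α f :=
    ⟨fun h => h.hasMeanOscillationBound hω hα1 (by linarith),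
      fun h => h.isBlochType hω hg hf (by linarith)⟩
  have h31 : HasWeightedLipschitzBound ω s α f → IsBlochType ω α f := fun h =>
    h.isBlochType hω hf.contDiffOn (by linarith) hαs
  refine ⟨fun hs => ?_, fun _ => ⟨h12, h31⟩⟩
  tfae_have 1 ↔ 2 := h12
  tfae_have 3 → 1 := h31
  tfae_have 1 → 3 := fun h => h.hasWeightedLipschitzBound hω hs hs1 (by linarith) hαs
  tfae_finish
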